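/- An ontic state of $n$ toy bits assigns to each bit $i\in\{1,\dots,n\}$ a pair $(X_i,Z_i)\in\mathbb{F}_2^2$, so each bit has four ontic states. A quadrature variable is an $\mathbb{F}_2$-linear combination $q=\sum_i (z_iZ_i+x_iX_i)$ and is encoded as the vector $(z_1,\dots,z_n,x_1,\dots,x_n)^T\in\mathbb{F}_2^{2n}$. The commutation relation is the bilinear form with $[X_i,Z_j]=[Z_j,X_i]=\delta_{ij}$ and $[X_i,X_j]=[Z_i,Z_j]=0$; $q$ and $q'$ commute if $[q,q']=0$. A toy state (of maximal knowledge) is a nonempty set of ontic states consisting of all ontic states at which the variables in some maximal set of commuting quadrature variables take prescribed values. A binary $2n\times n$ matrix is a check matrix of a toy state if the state is the set of all ontic states at which the $n$ quadrature variables given by its columns take some prescribed values. For a simple graph $G$ on $\{1,\dots,n\}$ with adjacency matrix $\theta$, a toy graph state with graph $G$ is a toy state with check matrix $\begin{pmatrix}\theta\\ I\end{pmatrix}$ (the values of the variables being arbitrary). A local toy transformation is an element $\sigma=(\sigma_1,\dots,\sigma_n)\in(S_4)^n$, where $\sigma_i$ permutes the four ontic states of bit $i$; two toy states are equivalent under local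 toy transformations if some $\sigma\in(S_4)^n$ maps one, as a set of ontic states, onto the other. The local complementation of a graph $G=(V,E)$ about $v\in V$ is $$G\star v=\bigl(V,\;E\,\triangle\,\{\{b,c\} : \{b,v\},\{c,v\}\in E,\ b\neq c\}\bigr).$$ **Theorem.** Let $G$ and $H$ be simple graphs on $\{1,\dots,n\}$, and let $\psi$ and $\varphi$ be toy graph states of $n$ toy bits with graphs $G$ and $H$, respectively. Then $\psi$ and $\varphi$ are equivalent under local toy transformations if and only if there is a finite (possibly empty) sequence of vertices $v_1,\dots,v_k$ such that $G\star v_1\star v_2\star\cdots\star v_k=H$. -/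

import Mathlib

namespace ToyTheory

/-- An ontic state of a single toy bit: the values `(X, Z)` of its two binary variables.
There are four of them. -/
abbrev ToyBit : Type := ZMod 2 × ZMod 2

/-- An ontic state of `n` toy bits. -/
abbrev OnticState (n : ℕ) : Type := Fin n → ToyBit

/-- A quadrature variable on `n` toy bits, as a binary vector of length `2n`: the entry at `Sum.inl i`
is the coefficient of `Z_i`, the entry at `Sum.inr i` is the coefficient of `X_i`
(so on each bit `Z ↦ 10`, `X ↦ 01`, `X ⊕ Z ↦ 11`). -/
abbrev QuadVar (n : ℕ) : Type := Fin n ⊕ Fin n → ZMod 2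

/-- The value of a quadrature variable at an ontic state. -/
def QuadVar.value {n : ℕ} (q : QuadVar n) (ω : OnticState n) : ZMod 2 :=
  ∑ i, (q (Sum.inl i) * (ω i).2 + q (Sum.inr i) * (ω i).1)

/-- The bilinear commutation relation, with `[X_i, Z_j] = [Z_j, X_i] = δ_ij` and
`[X_i, X_j] = [Z_i, Z_j] = 0`. -/
def QuadVar.comm {n : ℕ} (p q : QuadVar n) : ZMod 2 :=
  ∑ i, (p (Sum.inl i) * q (Sum.inr i) + p (Sum.inr i) * q (Sum.inl i))

/-- `Q` is a maximal set of commuting quadrature variables: its members commute with each other,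
and no quadrature variable outside `Q` commutes with all of them. -/
def IsMaximalCommuting {n : ℕ} (Q : Set (QuadVar n)) : Prop :=
  (∀ p ∈ Q, ∀ q ∈ Q, p.comm q = 0) ∧ ∀ q : QuadVar n, (∀ p ∈ Q, p.comm q = 0) → q ∈ Q

/-- A toy stabilizer state (an epistemic state of maximal knowledge) of `n` toy bits: the nonempty
set of all ontic states at which the variables in some maximal set of commuting quadrature
variables take prescribed values. -/
structure ToyState (n : ℕ) where
  carrier : Set (OnticState n)
  nonempty : carrier.Nonempty
  maximal_knowledge : ∃ (Q : Set (QuadVar n)) (val : QuadVar n → ZMod 2),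
    IsMaximalCommuting Q ∧ carrier = {ω | ∀ q ∈ Q, q.value ω = val q}

/-- The `2n × n` binary matrix `S` is a check matrix of the toy state `ψ`: its columns are `n`
quadrature variables which, together with suitable values for them, describe `ψ`.
(As `ψ` is a state of maximal knowledge, such columns automatically commute
and are linearly independent.) -/
def ToyState.HasCheckMatrix {n : ℕ} (ψ : ToyState n)
    (S : Matrix (Fin n ⊕ Fin n) (Fin n) (ZMod 2)) : Prop :=
  ∃ r : Fin n → ZMod 2, ψ.carrier = {ω | ∀ j, QuadVar.value (fun i => S i j) ω = r j}

open scoped Classical in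
/-- The check matrix of the graph states with graph `G`: the adjacency matrix of `G` on top of the
identity matrix. -/
noncomputable def graphCheckMatrix {n : ℕ} (G : SimpleGraph (Fin n)) :
    Matrix (Fin n ⊕ Fin n) (Fin n) (ZMod 2) :=
  Matrix.fromRows (G.adjMatrix (ZMod 2)) 1

/-- `ψ` is a toy graph state with underlying graph `G`. -/
def ToyState.IsGraphState {n : ℕ} (ψ : ToyState n) (G : SimpleGraph (Fin n)) : Prop :=
  ψ.HasCheckMatrix (graphCheckMatrix G)

/-- The local toy transformations of `n` toy bits, `(S_4)^n`: one permutation of the four ontic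
states for each toy bit. -/
abbrev LocalTransformation (n : ℕ) : Type := Fin n → Equiv.Perm ToyBit

/-- The action of a local toy transformation on ontic states, bit by bit. -/
def LocalTransformation.act {n : ℕ} (σ : LocalTransformation n) (ω : OnticState n) :
    OnticState n :=
  fun i => σ i (ω i)

/-- Some local toy transformation maps the toy state `ψ` to the toy state `φ`. -/
def LocallyEquivalent {n : ℕ} (ψ φ : ToyState n) : Prop :=
  ∃ σ : LocalTransformation n, σ.act '' ψ.carrier = φ.carrier

/-- The local complementation `G ⋆ v`: the edge set of `G` is replaced by its symmetric difference
with the set of all pairs of distinct neighbours of `v`. -/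
def localComplement {V : Type*} (G : SimpleGraph V) (v : V) : SimpleGraph V where
  Adj b c := Xor (G.Adj b c) (b ≠ c ∧ G.Adj b v ∧ G.Adj c v)
  symm := ⟨fun b c h => by
    simpa only [G.adj_comm c b, ne_comm (a := c) (b := b), and_comm (a := G.Adj c v)] using h⟩
  loopless := ⟨fun b h => by simp [Xor] at h⟩

end ToyTheory

namespace ToyTheory

open Finset

section Adjacency

variable {V : Type*}

/-! Every permutation of the four points of F_2^2 is affine, and a toy graph state is an affine
subspace x = θz + r. A local toy transformation between graph states therefore amounts, up to
translation, to invertible 2×2 blocks (a, b; c, d), one per bit, carrying x = θ_G z into x = θ_H z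
(`LinearEquivalence`). Conversely, local complementation is realised by local shears. Composing the
blocks with these shears gives a descent on the number of bits with c = 1; when none remain, the
graphs coincide (`exists_localComplements`). -/

open scoped Classical in
/-- The adjacency matrix of a graph over the field with two elements. -/
noncomputable def adj (G : SimpleGraph V) (i j : V) : ZMod 2 := if G.Adj i j then 1 else 0

lemma adj_comm (G : SimpleGraph V) (i j : V) : adj G i j = adj G j i := by
  by_cases h : G.Adj i j
  · simp [adj, h, h.symm]
  · simp [adj, h, show ¬ G.Adj j i from fun h' => h h'.symm]

@[simp] lemma adj_self (G : SimpleGraph V) (i : V) : adj G i i = 0 := by simp [adj]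

lemma adj_eq_one_iff {G : SimpleGraph V} {i j : V} : adj G i j = 1 ↔ G.Adj i j := by
  by_cases h : G.Adj i j <;> simp [adj, h]

lemma adj_eq_zero_of_ne_one {G : SimpleGraph V} {i j : V} (h : adj G i j ≠ 1) : adj G i j = 0 := by
  have : ∀ x : ZMod 2, x ≠ 1 → x = 0 := by decide
  exact this _ h

lemma adj_localComplement [DecidableEq V] (G : SimpleGraph V) (v i j : V) :
    adj (localComplement G v) i j =
      adj G i j + adj G i v * adj G j v + if i = j then adj G i v else 0 := by
  have h2 : (1 : ZMod 2) + 1 = 0 := by decide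
  by_cases hij : i = j
  · subst hij
    by_cases hi : G.Adj i v <;> simp [adj, localComplement, Xor, hi, h2]
  · by_cases h : G.Adj i j <;> by_cases hi : G.Adj i v <;> by_cases hj : G.Adj j v <;>
      simp [adj, localComplement, Xor, h, hi, hj, hij, h2]

variable [Fintype V]

/-- The adjacency matrix of a graph applied to a binary vector. -/
noncomputable def adjSum (G : SimpleGraph V) (z : V → ZMod 2) (i : V) : ZMod 2 :=
  ∑ j, adj G i j * z j

lemma adjSum_single [DecidableEq V] (G : SimpleGraph V) (i j : V) :
    adjSum G (Pi.single i 1) j = adj G j i := by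
  simp [adjSum, Pi.single_apply]

lemma adjSum_add (G : SimpleGraph V) (y z : V → ZMod 2) (i : V) :
    adjSum G (fun j => y j + z j) i = adjSum G y i + adjSum G z i := by
  simp [adjSum, mul_add, sum_add_distrib]

lemma adjSum_localComplement [DecidableEq V] (G : SimpleGraph V) (v : V) (z : V → ZMod 2)
    (t : ZMod 2) (i : V) :
    adjSum (localComplement G v) (fun j => z j + if j = v then t else 0) i =
      adjSum G z i + adj G i v * (adjSum G z v + t) + adj G i v * z i := by
  have h1 : adjSum (localComplement G v) z i =
      adjSum G z i + adj G i v * adjSum G z v + adj G i v * z i := by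
    simp only [adjSum, adj_localComplement, add_mul, sum_add_distrib, mul_sum, mul_assoc,
      ite_mul, zero_mul, sum_ite_eq, mem_univ, if_true, adj_comm G v]
  have h2 : adjSum (localComplement G v) (fun j => if j = v then t else 0) i = adj G i v * t := by
    by_cases hiv : i = v
    · subst hiv; simp [adjSum, adj_localComplement]
    · simp [adjSum, adj_localComplement, hiv]
  rw [adjSum_add, h1, h2]
  ring

/-! ### Descent by local complementation -/

/-- The matrices `(a i, b i; c i, d i)` are invertible, and together they map
the subspace `x = θ_G z` into the subspace `x = θ_H z`. -/
structure LinearEquivalence (G H : SimpleGraph V) (a b c d : V → ZMod 2) : Prop where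
  det : ∀ i, a i * d i + b i * c i = 1
  map : ∀ z i, a i * adjSum G z i + b i * z i =
    adjSum H (fun j => c j * adjSum G z j + d j * z j) i

/-- The new blocks are the old ones precomposed with the involutive shears z_v ↦ z_v + x_v at v and
x_w ↦ x_w + z_w at each neighbour w of v. -/
lemma LinearEquivalence.localComplement [DecidableEq V] {G H : SimpleGraph V}
    {a b c d : V → ZMod 2} (h : LinearEquivalence G H a b c d) (v : V) :
    LinearEquivalence (localComplement G v) H
      (fun w => a w + if w = v then b w else 0) (fun w => b w + adj G w v * a w)
      (fun w => c w + if w = v then d w else 0) (fun w => d w + adj G w v * c w) := by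
  have h2 : (2 : ZMod 2) = 0 := by decide
  refine ⟨fun i => ?_, fun z i => ?_⟩
  · have := h.det i
    by_cases hi : i = v
    · subst hi
      simp only [if_true, adj_self]
      linear_combination this + b i * d i * h2
    · simp only [hi, if_false]
      linear_combination this + a i * adj G i v * c i * h2
  · set t := adjSum (ToyTheory.localComplement G v) z v with ht
    -- `y` is the z-part after the shear at v; since v is not its own neighbour, t is also the
    -- x-value of `y` at v.
    set y : V → ZMod 2 := fun j => z j + if j = v then t else 0 with hy
    have hz : z = fun j => y j + if j = v then t else 0 := by
      funext j
      by_cases hj : j = v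
      · simp only [hy, hj, if_true]; linear_combination -t * h2
      · simp [hy, hj]
    have hx : ∀ j, adjSum (ToyTheory.localComplement G v) z j =
        adjSum G y j + adj G j v * (adjSum G y v + t) + adj G j v * y j := by
      intro j
      rw [← adjSum_localComplement, ← hz]
    have hv : t = adjSum G y v := by simpa using hx v
    have hx' : ∀ j, adjSum (ToyTheory.localComplement G v) z j =
        adjSum G y j + adj G j v * y j := by
      intro j
      rw [hx j, ← hv]
      linear_combination adj G j v * t * h2
    have key : ∀ (p q : V → ZMod 2) j,
        (p j + if j = v then q j else 0) * adjSum (ToyTheory.localComplement G v) z j +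
          (q j + adj G j v * p j) * z j = p j * adjSum G y j + q j * y j := by
      intro p q j
      by_cases hj : j = v
      · subst hj
        rw [← ht, ← hv]
        simp only [if_true, adj_self, hy]
        ring
      · rw [hx' j]
        simp only [hj, if_false, hy, add_zero]
        linear_combination adj G j v * p j * z j * h2
    simp only [key]
    exact h.map y i

/-- The determinant forces a = d = 1, and b only affects diagonal entries, so basis vectors compare
the two adjacency matrices off the diagonal. -/
lemma LinearEquivalence.eq_of_forall_eq_zero {G H : SimpleGraph V} {a b c d : V → ZMod 2}
    (h : LinearEquivalence G H a b c d) (hc : ∀ i, c i = 0) : G = H := by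
  classical
  have had : ∀ i, a i = 1 ∧ d i = 1 := by
    intro i
    have := h.det i
    rw [hc i] at this
    have aux : ∀ p q r : ZMod 2, p * q + r * 0 = 1 → p = 1 ∧ q = 1 := by decide
    exact aux _ _ _ this
  ext i j
  by_cases hij : i = j
  · simp [hij]
  have := h.map (Pi.single j 1) i
  simp only [hc, fun i => (had i).1, fun i => (had i).2, zero_mul, zero_add, one_mul,
    adjSum_single, Pi.single_eq_of_ne hij, mul_zero, add_zero] at this
  rw [← adj_eq_one_iff, ← adj_eq_one_iff, this]

/-- Otherwise the image of the basis vector at i has zero z-part, hence zero x-part; its x-entry at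
i is b i, which the determinant makes 1. -/
lemma LinearEquivalence.exists_adj {G H : SimpleGraph V} {a b c d : V → ZMod 2}
    (h : LinearEquivalence G H a b c d) (hd : ∀ i, c i = 1 → d i = 0) {i : V} (hi : c i = 1) :
    ∃ j, c j = 1 ∧ adj G j i = 1 := by
  classical
  by_contra! hn
  have hmap := h.map (Pi.single i 1) i
  have h0 : ∀ j, c j * adj G j i + d j * (Pi.single i 1 : V → ZMod 2) j = 0 := by
    intro j
    have aux : ∀ x : ZMod 2, x ≠ 1 → x = 0 := by decide
    by_cases hj : c j = 1
    · rw [hd j hj, adj_eq_zero_of_ne_one (hn j hj)]; simp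
    · have : j ≠ i := by rintro rfl; exact hj hi
      simp [aux _ hj, this]
  simp only [adjSum_single, h0, adj_self] at hmap
  have hdet := h.det i
  rw [hd i hi, hi] at hdet
  simp_all [adjSum]

lemma LinearEquivalence.exists_localComplements {G H : SimpleGraph V} {a b c d : V → ZMod 2}
    (h : LinearEquivalence G H a b c d) :
    ∃ vs : List V, vs.foldl ToyTheory.localComplement G = H := by
  classical
  induction hm : #{i | c i = 1} using Nat.strong_induction_on generalizing G a b c d with
  | _ m ih =>
  have h2 : (1 : ZMod 2) + 1 = 0 := by decide
  -- If c v = d v = 1, complementing at v turns c v into 0 and leaves every other c unchanged.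
  have red : ∀ {G : SimpleGraph V} {a b c' d : V → ZMod 2}, LinearEquivalence G H a b c' d →
      #{i | c' i = 1} = m → ∀ v, c' v = 1 → d v = 1 →
      ∃ vs : List V, vs.foldl ToyTheory.localComplement G = H := by
    intro G a b c' d h hm v hv hdv
    obtain ⟨vs, hvs⟩ := ih _ (by
      rw [← hm]
      refine card_lt_card (ssubset_iff_of_subset ?_ |>.2 ⟨v, by simp [hv], ?_⟩)
      rotate_left
      · simp [hv, hdv, h2]
      · intro w hw
        by_cases hwv : w = v
        · subst hwv; simpa using hv
        · simpa [hwv] using hw) (h.localComplement v) rfl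
    exact ⟨v :: vs, hvs⟩
  by_cases hc : ∀ i, c i = 0
  · exact ⟨[], h.eq_of_forall_eq_zero hc⟩
  have bin : ∀ x : ZMod 2, x ≠ 0 → x = 1 := by decide
  have bin' : ∀ x : ZMod 2, x ≠ 1 → x = 0 := by decide
  by_cases hd : ∃ i, c i = 1 ∧ d i = 1
  · obtain ⟨i, hi, hdi⟩ := hd
    exact red h hm i hi hdi
  · push Not at hc hd
    obtain ⟨i, hi⟩ := hc
    have hi := bin _ hi
    have hd' : ∀ i, c i = 1 → d i = 0 := fun j hj => bin' _ (hd j hj)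
    obtain ⟨j, hj, hji⟩ := h.exists_adj hd' hi
    -- As d i = 0, complementing at i preserves c, while it raises d j to 1 at the neighbour j, so
    -- `red` applies there.
    have hc' : (fun w => c w + if w = i then d w else 0) = c := by
      funext w
      by_cases hw : w = i
      · subst hw; simp [hd' _ hi]
      · simp [hw]
    have h' := h.localComplement i
    rw [hc'] at h'
    obtain ⟨vs, hvs⟩ := red h' hm j hj (by simp [hd' j hj, hji, hj])
    exact ⟨i :: vs, hvs⟩

end Adjacency

/-! ### From toy states to linear algebra and back -/

variable {n : ℕ}

/-- The ontic states with `x = θ z + r`, where `θ` is the adjacency matrix of `G`. -/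
def graphSet (G : SimpleGraph (Fin n)) (r : Fin n → ZMod 2) : Set (OnticState n) :=
  {ω | ∀ j, adjSum G (fun i => (ω i).2) j + (ω j).1 = r j}

lemma ToyState.IsGraphState.exists_carrier_eq {ψ : ToyState n} {G : SimpleGraph (Fin n)}
    (h : ψ.IsGraphState G) : ∃ r, ψ.carrier = graphSet G r := by
  obtain ⟨r, hr⟩ := h
  refine ⟨r, hr.trans ?_⟩
  ext ω
  simp only [graphSet, Set.mem_ofPred_eq]
  refine forall_congr' fun j => ?_
  have : QuadVar.value (fun i => graphCheckMatrix G i j) ω =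
      adjSum G (fun i => (ω i).2) j + (ω j).1 := by
    simp only [adjSum, adj_comm G j]
    simp [QuadVar.value, graphCheckMatrix, sum_add_distrib, Matrix.one_apply, adj,
      SimpleGraph.adjMatrix_apply]
  rw [this]

/-- S_4 is the affine group of F_2^2 (24 = 4 · 6); checked by enumeration. -/
lemma exists_affine (σ : Equiv.Perm ToyBit) : ∃ a b c d e f : ZMod 2, a * d + b * c = 1 ∧
    ∀ x z, σ (x, z) = (a * x + b * z + e, c * x + d * z + f) := by
  revert σ
  decide

lemma LinearEquivalence.of_image_graphSet {G H : SimpleGraph (Fin n)} {r s : Fin n → ZMod 2}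
    (σ : LocalTransformation n) (h : σ.act '' graphSet G r ⊆ graphSet H s) :
    ∃ a b c d, LinearEquivalence G H a b c d := by
  have h2 : (2 : ZMod 2) = 0 := by decide
  choose a b c d e f hdet hσ using fun i => exists_affine (σ i)
  refine ⟨a, b, c, d, hdet, fun z i => ?_⟩
  have key : ∀ z : Fin n → ZMod 2,
      adjSum H (fun j => c j * adjSum G z j + d j * z j) i +
        adjSum H (fun j => c j * r j + f j) i +
        (a i * (r i + adjSum G z i) + b i * z i + e i) = s i := by
    intro z
    have hmem : (fun j => (r j + adjSum G z j, z j) : OnticState n) ∈ graphSet G r := by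
      intro j
      linear_combination adjSum G z j * h2
    have := h ⟨_, hmem, rfl⟩ i
    simp only [LocalTransformation.act, hσ] at this
    rw [← adjSum_add, ← this]
    congr 2
    funext j
    ring
  -- The case z = 0 isolates the constant terms, which then cancel.
  have k0 : adjSum H (fun j => c j * r j + f j) i + (a i * r i + e i) = s i := by
    simpa [adjSum] using key 0
  linear_combination key z - k0 - adjSum H (fun j => c j * adjSum G z j + d j * z j) i * h2

/-- The shear of one toy bit adding `p * z` to `x` and `q * x` to `z`, when `p * q = 0`. -/
def shear (p q : ZMod 2) (hpq : p * q = 0) : Equiv.Perm ToyBit where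
  toFun ω := (ω.1 + p * ω.2, ω.2 + q * ω.1)
  invFun ω := (ω.1 + p * ω.2, ω.2 + q * ω.1)
  left_inv := by revert p q; decide
  right_inv := by revert p q; decide

/-- A local toy transformation maps some set of the form `x = θ_G z + r` onto `x = θ_H z + s`. -/
def GraphSetEquiv (G H : SimpleGraph (Fin n)) (r s : Fin n → ZMod 2) : Prop :=
  ∃ σ : LocalTransformation n, ∀ ω, ω ∈ graphSet G r ↔ σ.act ω ∈ graphSet H s

lemma GraphSetEquiv.image_eq {G H : SimpleGraph (Fin n)} {r s : Fin n → ZMod 2}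
    (h : GraphSetEquiv G H r s) : ∃ σ : LocalTransformation n,
      σ.act '' graphSet G r = graphSet H s := by
  obtain ⟨σ, hσ⟩ := h
  refine ⟨σ, Set.Subset.antisymm ?_ fun ω hω => ?_⟩
  · rintro _ ⟨ω, hω, rfl⟩
    exact (hσ ω).1 hω
  · have : σ.act (fun i => (σ i).symm (ω i)) = ω := by
      funext i
      simp [LocalTransformation.act]
    exact ⟨_, (hσ _).2 (by rwa [this]), this⟩

lemma GraphSetEquiv.trans {G H K : SimpleGraph (Fin n)} {r s t : Fin n → ZMod 2}
    (h₁ : GraphSetEquiv G H r s) (h₂ : GraphSetEquiv H K s t) : GraphSetEquiv G K r t := by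
  obtain ⟨σ, hσ⟩ := h₁
  obtain ⟨τ, hτ⟩ := h₂
  exact ⟨fun i => (σ i).trans (τ i), fun ω => (hσ ω).trans (hτ _)⟩

lemma GraphSetEquiv.translate (G : SimpleGraph (Fin n)) (r s : Fin n → ZMod 2) :
    GraphSetEquiv G G r s := by
  refine ⟨fun i => Equiv.addRight ((s i - r i, 0) : ToyBit), fun ω => forall_congr' fun j => ?_⟩
  simp only [LocalTransformation.act, Equiv.coe_addRight, Prod.fst_add, Prod.snd_add, add_zero]
  constructor <;> intro h <;> linear_combination h

lemma GraphSetEquiv.localComplement (G : SimpleGraph (Fin n)) (v : Fin n) :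
    GraphSetEquiv G (localComplement G v) 0 0 := by
  have h2 : (2 : ZMod 2) = 0 := by decide
  refine ⟨fun i => shear (adj G i v) (if i = v then 1 else 0) ?_, fun ω => ?_⟩
  · by_cases hi : i = v <;> simp [hi]
  have hsum : ∀ j, adjSum (ToyTheory.localComplement G v)
      (fun i => (ω i).2 + (if i = v then 1 else 0) * (ω i).1) j =
      adjSum G (fun i => (ω i).2) j + adj G j v * (adjSum G (fun i => (ω i).2) v + (ω v).1) +
        adj G j v * (ω j).2 := by
    intro j
    rw [← adjSum_localComplement]
    congr 1
    funext i
    by_cases hi : i = v <;> simp [hi]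
  simp only [graphSet, Set.mem_ofPred_eq, LocalTransformation.act, shear, Equiv.coe_fn_mk, hsum,
    Pi.zero_apply]
  constructor
  · intro h j
    linear_combination h j + adj G j v * h v + adj G j v * (ω j).2 * h2
  -- The equation at v must be recovered first: it enters every neighbour's equation.
  · intro h j
    have hv := h v
    simp only [adj_self, zero_mul, add_zero] at hv
    linear_combination h j - adj G j v * hv - adj G j v * (ω j).2 * h2

lemma GraphSetEquiv.foldl_localComplement (vs : List (Fin n)) (G : SimpleGraph (Fin n)) :
    GraphSetEquiv G (vs.foldl ToyTheory.localComplement G) 0 0 := by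
  induction vs generalizing G with
  | nil => exact GraphSetEquiv.translate G 0 0
  | cons v vs ih => exact (GraphSetEquiv.localComplement G v).trans (ih _)

end ToyTheory

theorem mainTheorem7 (n : ℕ) (G H : SimpleGraph (Fin n)) (ψ φ : ToyTheory.ToyState n)
    (hψ : ψ.IsGraphState G) (hφ : φ.IsGraphState H) :
    ToyTheory.LocallyEquivalent ψ φ ↔
      ∃ vs : List (Fin n), vs.foldl ToyTheory.localComplement G = H := by
  obtain ⟨r, hr⟩ := hψ.exists_carrier_eq
  obtain ⟨s, hs⟩ := hφ.exists_carrier_eq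
  rw [ToyTheory.LocallyEquivalent, hr, hs]
  constructor
  · rintro ⟨σ, hσ⟩
    obtain ⟨a, b, c, d, h⟩ := ToyTheory.LinearEquivalence.of_image_graphSet σ hσ.subset
    exact h.exists_localComplements
  · rintro ⟨vs, rfl⟩
    exact ((ToyTheory.GraphSetEquiv.translate G r 0).trans
      ((ToyTheory.GraphSetEquiv.foldl_localComplement vs G).trans
        (ToyTheory.GraphSetEquiv.translate _ 0 s))).image_eq
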